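/- Let $(X,\mu)$ be a standard Borel space with a $\sigma$-finite measure, $\mu(X)=\infty$, and let $T:X\to X$ be an invertible measure-preserving transformation of rank one: there are measurable partitions $\xi_j=\{E_j,TE_j,\dots,T^{h_j}E_j,\tilde E_j\}$ of $X$ such that for every set $A$ of finite measure and every $\varepsilon>0$, for all sufficiently large $j$ there is a union $S$ of elements of $\xi_j$ with $\mu(A\,\triangle\,S)<\varepsilon$. Write $T$ also for the operator $Tf(x)=f(Tx)$ on $L_2(X,\mu)$. Suppose that the weak closure of the powers of $T$ is polynomial, i.e. every operator in the closure of $\{T^n:n\in\mathbb Z\}$ in the weak operator topology is a (finite) linear combination of powers $T^n$, $n\in\mathbb Z$. A self-joining of $T$ is a measure $\nu$ on $X\times X$ with $(T\times T)\nu=\nu$ and $\nu(X\times A)=\nu(A\times X)=\mu(A)$ for every set $A$ of finite measure. For a measure-preserving $S$ let $\Delta_S=(\mathrm{Id}\times S)\Delta$, where $\Delta(A\times B)=\mu(A\cap B)$. Then $T$ has minimal self-joinings: the self-joinings of $T$ that are ergodic with respect to $T\times T$ are exactly the measures $\Delta_{T^n}$, $n\in\mathbb Z$. In particular $T$ has trivial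 centralizer: every invertible measure-preserving transformation $S$ of $(X,\mu)$ with $ST=TS$ almost everywhere coincides almost everywhere with $T^n$ for some $n\in\mathbb Z$. -/

import Mathlib

open MeasureTheory Set Filter
open scoped ENNReal Topology

noncomputable section

namespace RankOneJoinings

variable {X : Type*} [MeasurableSpace X]

/-- The integer power `T ^ n` of an invertible measurable map, as a map `X → X`. -/
def zpowMap (T : X ≃ᵐ X) (n : ℤ) : X → X :=
  ⇑((T.toEquiv : Equiv.Perm X) ^ n)

theorem zpowMap_natCast (T : X ≃ᵐ X) (n : ℕ) : zpowMap T (n : ℤ) = T^[n] := by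
  unfold zpowMap
  rw [zpow_natCast, Equiv.Perm.coe_pow]
  rfl

theorem zpowMap_negSucc (T : X ≃ᵐ X) (n : ℕ) :
    zpowMap T (Int.negSucc n) = T.symm^[n + 1] := by
  unfold zpowMap
  rw [zpow_negSucc, ← inv_pow, Equiv.Perm.coe_pow]
  rfl

theorem measurePreserving_zpowMap {μ : Measure X} {T : X ≃ᵐ X}
    (hT : MeasurePreserving T μ μ) (n : ℤ) : MeasurePreserving (zpowMap T n) μ μ := by
  cases n with
  | ofNat n =>
    rw [Int.ofNat_eq_natCast, zpowMap_natCast]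
    exact hT.iterate n
  | negSucc n =>
    rw [zpowMap_negSucc]
    exact (MeasurePreserving.symm T hT).iterate (n + 1)

/-- The `i`-th level `T ^ i E` of the tower with base `E`. -/
def level (T : X ≃ᵐ X) (E : Set X) (i : ℕ) : Set X := (T^[i]) '' E

/-- The remaining part of the space outside the levels `E, T E, …, T ^ h E`. -/
def towerRest (T : X ≃ᵐ X) (E : Set X) (h : ℕ) : Set X :=
  (⋃ i ∈ Finset.range (h + 1), level T E i)ᶜ

/-- `S` is a union of elements of the partition `{E, T E, …, T ^ h E, Ẽ}`. -/
def IsPartitionMeasurable (T : X ≃ᵐ X) (E : Set X) (h : ℕ) (S : Set X) : Prop :=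
  ∃ I ⊆ Finset.range (h + 1),
    S = (⋃ i ∈ I, level T E i) ∨ S = (⋃ i ∈ I, level T E i) ∪ towerRest T E h

/-- `T` has rank one: there are measurable partitions
`ξ_j = {E_j, T E_j, …, T ^ (h_j) E_j, Ẽ_j}` such that every set of finite measure is approximated
arbitrarily well, for all sufficiently large `j`, by `ξ_j`-measurable sets. -/
def IsRankOne (μ : Measure X) (T : X ≃ᵐ X) : Prop :=
  ∃ (E : ℕ → Set X) (h : ℕ → ℕ),
    (∀ j, MeasurableSet (E j)) ∧
    (∀ j, ((Finset.range (h j + 1) : Finset ℕ) : Set ℕ).PairwiseDisjoint (level T (E j))) ∧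
    ∀ A : Set X, MeasurableSet A → μ A < ∞ → ∀ ε : ℝ≥0∞, 0 < ε →
      ∀ᶠ j in atTop, ∃ S : Set X, IsPartitionMeasurable T (E j) (h j) S ∧ μ (symmDiff A S) < ε

/-- The operator `f ↦ f ∘ T ^ n` on `L²(X, μ)`. -/
def koopman (μ : Measure X) (T : X ≃ᵐ X) (hT : MeasurePreserving T μ μ) (n : ℤ) :
    Lp ℂ 2 μ →L[ℂ] Lp ℂ 2 μ :=
  (Lp.compMeasurePreservingₗᵢ ℂ (zpowMap T n)
    (measurePreserving_zpowMap hT n)).toContinuousLinearMap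

/-- The set of all powers `T ^ n`, `n ∈ ℤ`, inside the space of bounded operators on `L²(X, μ)`
with the weak operator topology. -/
def powersWOT (μ : Measure X) (T : X ≃ᵐ X) (hT : MeasurePreserving T μ μ) :
    Set (Lp ℂ 2 μ →WOT[ℂ] Lp ℂ 2 μ) :=
  range fun n : ℤ => ContinuousLinearMapWOT.ofCLM (koopman μ T hT n)

/-- The weak closure of the powers of `T` is polynomial: every element of it is a
(finite) linear combination of powers of `T`. -/
def HasPolynomialWeakClosure (μ : Measure X) (T : X ≃ᵐ X) (hT : MeasurePreserving T μ μ) : Prop :=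
  closure (powersWOT μ T hT) ⊆
    (Submodule.span ℂ (powersWOT μ T hT) : Set (Lp ℂ 2 μ →WOT[ℂ] Lp ℂ 2 μ))

/-- A self-joining of `T`: a `T × T`-invariant measure on `X × X` with
`ν (X × A) = ν (A × X) = μ A` for every set `A` of finite measure. -/
structure IsSelfJoining (μ : Measure X) (T : X ≃ᵐ X) (ν : Measure (X × X)) : Prop where
  map_eq : ν.map (Prod.map T T) = ν
  univ_prod : ∀ A : Set X, MeasurableSet A → μ A < ∞ → ν (univ ×ˢ A) = μ A
  prod_univ : ∀ A : Set X, MeasurableSet A → μ A < ∞ → ν (A ×ˢ univ) = μ A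

/-- The measure `Δ_S = (Id × S) Δ`, where `Δ` is the diagonal measure
`Δ (A × B) = μ (A ∩ B)`. -/
def graphMeasure (μ : Measure X) (S : X → X) : Measure (X × X) :=
  (μ.map fun x => (x, x)).map (Prod.map id S)

/-- Minimal self-joinings: the ergodic self-joinings of `T` are exactly the measures
`Δ_{T ^ n}`, `n ∈ ℤ`. -/
def HasMinimalSelfJoinings (μ : Measure X) (T : X ≃ᵐ X) : Prop :=
  ∀ ν : Measure (X × X),
    (IsSelfJoining μ T ν ∧ Ergodic (Prod.map T T) ν) ↔
      ∃ n : ℤ, ν = graphMeasure μ (zpowMap T n)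

/-- Trivial centralizer: every invertible measure-preserving map commuting with `T`
(almost everywhere) is (almost everywhere) a power of `T`. -/
def HasTrivialCentralizer (μ : Measure X) (T : X ≃ᵐ X) : Prop :=
  ∀ S : X ≃ᵐ X, MeasurePreserving S μ μ → (∀ᵐ x ∂μ, S (T x) = T (S x)) →
    ∃ n : ℤ, ∀ᵐ x ∂μ, S x = zpowMap T n x

end RankOneJoinings

end

/-! A self-joining `ν` gives the rectangle `T^a E × T^b E` of tower levels a mass that depends only
on `b - a`, and for offsets of absolute value at most `h` these masses sum to at most `2 μ E`. On
rectangles made of levels, `ν` is therefore dominated by an average over offsets, and the best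
offset `k` satisfies `ν ≤ 2 Δ_{T^k}` summed over any given finite family
(`exists_sum_levelUnion_le`). Rank one extends this, up to a small error, to arbitrary rectangles of
finite measure (`exists_sum_prod_le`).

Suppose `ν` gives zero mass to the graph of every power. Then there are decreasing finite unions of
rectangles `R m` whose `ν`-mass stays bounded below while `Δ_{T^n} (R m) → 0` for each `n`
(`exists_separating`). Domination yields `k m` with `Δ_{T^(k m)} (R m)` bounded below. A weak limit
`P` of the operators `T^(k m)` is a finite combination `∑ a n • T^n`. The functional attached to `R
l` is bounded below in modulus at `P`, since the sets decrease, yet its value `∑ a n Δ_{T^n} (R l)`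
tends to `0`: a contradiction.

So `ν` charges some graph (`exists_graphSet_ne_zero`). Graphs are invariant, so an ergodic `ν` lives
on one of them and is determined by its first marginal. Conversely, graph joinings are copies of
`(T, μ)`, which rank one makes ergodic; applied to the graph of a commuting `S`, this gives the
centralizer. -/

namespace RankOneJoinings

variable {X : Type*} [MeasurableSpace X]

/-! ### Powers of `T` and tower levels. -/

theorem zpowMap_comm (T : X ≃ᵐ X) (n : ℤ) (x : X) : zpowMap T n (T x) = T (zpowMap T n x) := by
  have h := (Commute.zpow_self (T.toEquiv : Equiv.Perm X) n).eq
  exact congrArg (fun f : Equiv.Perm X => f x) h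

theorem zpowMap_iterate (T : X ≃ᵐ X) {a b : ℕ} {k : ℤ} (h : (b : ℤ) - a = k) (x : X) :
    zpowMap T k (T^[a] x) = T^[b] x := by
  have hb : (b : ℤ) = k + a := by omega
  rw [← zpowMap_natCast T a, ← zpowMap_natCast T b, hb]
  unfold zpowMap
  rw [zpow_add]
  rfl

theorem measurable_zpowMap (T : X ≃ᵐ X) (n : ℤ) : Measurable (zpowMap T n) := by
  cases n with
  | ofNat n => rw [Int.ofNat_eq_natCast, zpowMap_natCast]; exact T.measurable.iterate n
  | negSucc n => rw [zpowMap_negSucc]; exact T.symm.measurable.iterate (n + 1)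

theorem level_eq_preimage (T : X ≃ᵐ X) (E : Set X) (i : ℕ) :
    level T E i = (T.symm^[i]) ⁻¹' E :=
  congrFun (image_eq_preimage_of_inverse
    (Function.LeftInverse.iterate T.symm_apply_apply i)
    (Function.RightInverse.iterate (g := T.symm) (f := T) T.apply_symm_apply i)) E

theorem measurableSet_level (T : X ≃ᵐ X) {E : Set X} (hE : MeasurableSet E) (i : ℕ) :
    MeasurableSet (level T E i) := by
  rw [level_eq_preimage]
  exact T.symm.measurable.iterate i hE

theorem level_zero (T : X ≃ᵐ X) (E : Set X) : level T E 0 = E := by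
  simp [level]

theorem preimage_level_succ (T : X ≃ᵐ X) (E : Set X) (i : ℕ) :
    T ⁻¹' level T E (i + 1) = level T E i := by
  unfold level
  rw [Function.iterate_succ', image_comp, preimage_image_eq _ T.injective]

theorem measure_level {μ : Measure X} {T : X ≃ᵐ X} (hT : MeasurePreserving T μ μ) {E : Set X}
    (hE : MeasurableSet E) (i : ℕ) : μ (level T E i) = μ E := by
  rw [level_eq_preimage]
  exact ((MeasurePreserving.symm T hT).iterate i).measure_preimage hE.nullMeasurableSet

theorem measure_inter_level {μ : Measure X} {T : X ≃ᵐ X} (hT : MeasurePreserving T μ μ)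
    {A E : Set X} (hA : MeasurableSet A) (hinv : T ⁻¹' A = A) (hE : MeasurableSet E) (i : ℕ) :
    μ (A ∩ level T E i) = μ (A ∩ E) := by
  have hs : T.symm ⁻¹' A = A := by
    conv_lhs => rw [← hinv]
    ext x; simp
  have hsi : (T.symm^[i]) ⁻¹' A = A := by
    induction i with
    | zero => rfl
    | succ i ih => rw [Function.iterate_succ, preimage_comp, ih, hs]
  rw [level_eq_preimage]
  conv_lhs => rw [← hsi]
  rw [← preimage_inter]
  exact ((MeasurePreserving.symm T hT).iterate i).measure_preimage (hA.inter hE).nullMeasurableSet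

/-- The union of the levels with indices in `I`. -/
def levelUnion (T : X ≃ᵐ X) (E : Set X) (I : Finset ℕ) : Set X := ⋃ i ∈ I, level T E i

theorem levelUnion_empty (T : X ≃ᵐ X) (E : Set X) : levelUnion T E ∅ = ∅ := by
  simp [levelUnion]

theorem measurableSet_levelUnion (T : X ≃ᵐ X) {E : Set X} (hE : MeasurableSet E)
    (I : Finset ℕ) : MeasurableSet (levelUnion T E I) :=
  Finset.measurableSet_biUnion _ fun i _ => measurableSet_level T hE i

theorem measure_inter_levelUnion {μ : Measure X} {T : X ≃ᵐ X} (hT : MeasurePreserving T μ μ)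
    {A E : Set X} (hA : MeasurableSet A) (hinv : T ⁻¹' A = A) (hE : MeasurableSet E)
    {I : Finset ℕ} (hI : (I : Set ℕ).PairwiseDisjoint (level T E)) :
    μ (A ∩ levelUnion T E I) = I.card * μ (A ∩ E) := by
  unfold levelUnion
  rw [inter_iUnion₂, measure_biUnion_finset
    (hI.mono fun i => inter_subset_right) fun i _ => hA.inter (measurableSet_level T hE i)]
  simp [measure_inter_level hT hA hinv hE]

theorem measure_levelUnion {μ : Measure X} {T : X ≃ᵐ X} (hT : MeasurePreserving T μ μ)
    {E : Set X} (hE : MeasurableSet E)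
    {I : Finset ℕ} (hI : (I : Set ℕ).PairwiseDisjoint (level T E)) :
    μ (levelUnion T E I) = I.card * μ E := by
  simpa using measure_inter_levelUnion hT MeasurableSet.univ preimage_univ hE hI

theorem measure_le_add_symmDiff (μ : Measure X) (A S : Set X) : μ A ≤ μ S + μ (symmDiff A S) := by
  refine (measure_mono fun x hx => ?_).trans (measure_union_le _ _)
  by_cases h : x ∈ S
  · exact Or.inl h
  · exact Or.inr (Or.inl ⟨hx, h⟩)

/-! ### Approximation by tower levels and ergodicity. -/

theorem exists_disjoint_pos_measure {μ : Measure X} [SigmaFinite μ] (hinf : μ univ = ∞) :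
    ∃ C D : Set X, MeasurableSet C ∧ MeasurableSet D ∧ Disjoint C D ∧ 0 < μ C ∧ μ C < ∞ ∧
      0 < μ D ∧ μ D < ∞ := by
  obtain ⟨C, hC, -, hC0, hCf⟩ := μ.exists_subset_measure_lt_top (r := 0) MeasurableSet.univ
    (by rw [hinf]; exact ENNReal.zero_lt_top)
  have hcompl : 0 < μ Cᶜ := by
    rw [measure_compl hC hCf.ne, hinf, ENNReal.top_sub hCf.ne]
    exact ENNReal.zero_lt_top
  obtain ⟨D, hD, hDC, hD0, hDf⟩ := μ.exists_subset_measure_lt_top (r := 0) hC.compl hcompl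
  exact ⟨C, D, hC, hD, (disjoint_compl_right.mono_right hDC), hC0, hCf, hD0, hDf⟩

/-- In infinite measure, sets of finite measure are approximated by unions of levels. -/
theorem IsRankOne.exists_levelUnion {μ : Measure X} [SigmaFinite μ] (hinf : μ univ = ∞)
    {T : X ≃ᵐ X} (hT : MeasurePreserving T μ μ) (hrank : IsRankOne μ T) :
    ∃ (E : ℕ → Set X) (h : ℕ → ℕ), (∀ j, MeasurableSet (E j)) ∧
      (∀ j, ((Finset.range (h j + 1) : Finset ℕ) : Set ℕ).PairwiseDisjoint (level T (E j))) ∧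
      ∀ A : Set X, MeasurableSet A → μ A < ∞ → ∀ ε : ℝ≥0∞, 0 < ε →
        ∀ᶠ j in atTop, ∃ I ⊆ Finset.range (h j + 1),
          μ (symmDiff A (levelUnion T (E j) I)) < ε := by
  obtain ⟨E, h, hE, hdisj, happ⟩ := hrank
  refine ⟨E, h, hE, hdisj, fun A hA hAf ε hε => ?_⟩
  obtain ⟨C, D, hC, hD, hCD, hC0, hCf, hD0, hDf⟩ := exists_disjoint_pos_measure hinf
  have hmin : 0 < min (μ C / 2) (μ D / 2) :=
    lt_min (ENNReal.half_pos hC0.ne') (ENNReal.half_pos hD0.ne')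
  -- If the levels had infinite measure, a good approximant of `C` or `D` could contain no level and
  -- could not be empty, so both would be approximated by the same `towerRest`, which is impossible
  -- for disjoint sets.
  have hfin : ∀ᶠ j in atTop, μ (E j) ≠ ∞ := by
    filter_upwards [happ C hC hCf _ hmin, happ D hD hDf _ hmin]
      with j ⟨S, hS, hCS⟩ ⟨S', hS', hDS⟩ hj
    have key : ∀ B S : Set X, μ B < ∞ → min (μ C / 2) (μ D / 2) ≤ μ B →
        IsPartitionMeasurable T (E j) (h j) S → μ (symmDiff B S) < min (μ C / 2) (μ D / 2) →
        S = towerRest T (E j) (h j) := by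
      rintro B S hBf hBm ⟨I, hI, hS⟩ hBS
      have hSf : μ S < ∞ := by
        refine (measure_le_add_symmDiff μ S B).trans_lt ?_
        rw [symmDiff_comm]
        exact ENNReal.add_lt_top.2 ⟨hBf, hBS.trans_le le_top⟩
      have hI0 : I = ∅ := by
        rw [Finset.eq_empty_iff_forall_notMem]
        intro i hi
        have : level T (E j) i ⊆ S := by
          rcases hS with rfl | rfl
          · exact subset_biUnion_of_mem (u := level T (E j)) hi
          · exact (subset_biUnion_of_mem (u := level T (E j)) hi).trans subset_union_left
        have := measure_mono (μ := μ) this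
        rw [measure_level hT (hE j), hj] at this
        exact hSf.not_ge this
      subst hI0
      rcases hS with rfl | rfl
      · exfalso
        refine hBS.not_ge (hBm.trans_eq ?_)
        rw [← levelUnion, levelUnion_empty, ← bot_eq_empty, symmDiff_bot]
      · simp
    have e1 := key C S hCf ((min_le_left _ _).trans ENNReal.half_le_self) hS hCS
    have e2 := key D S' hDf ((min_le_right _ _).trans ENNReal.half_le_self) hS' hDS
    subst e1 e2
    have : C ⊆ symmDiff C (towerRest T (E j) (h j)) ∪ symmDiff D (towerRest T (E j) (h j)) := by
      intro x hx
      have hxD : x ∉ D := fun hx' => disjoint_left.1 hCD hx hx'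
      by_cases hr : x ∈ towerRest T (E j) (h j)
      · exact Or.inr (Or.inr ⟨hr, hxD⟩)
      · exact Or.inl (Or.inl ⟨hx, hr⟩)
    have h1 := (measure_mono (μ := μ) this).trans (measure_union_le _ _)
    have h2 := ENNReal.add_lt_add (hCS.trans_le (min_le_left _ _)) (hDS.trans_le (min_le_left _ _))
    rw [ENNReal.add_halves] at h2
    exact h2.not_ge h1
  -- The cap `1` keeps the error finite even for `ε = ∞`; this excludes approximants containing the
  -- rest of the tower, which has infinite measure.
  filter_upwards [hfin, happ A hA hAf (min ε 1) (lt_min hε one_pos)] with j hj ⟨S, ⟨I, hI, hS⟩, hAS⟩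
  refine ⟨I, hI, ?_⟩
  rcases hS with rfl | rfl
  · exact hAS.trans_le (min_le_left _ _)
  · exfalso
    have hrest : μ (towerRest T (E j) (h j)) = ∞ := by
      have hm : MeasurableSet (levelUnion T (E j) (Finset.range (h j + 1))) :=
        measurableSet_levelUnion T (hE j) _
      have hf : μ (levelUnion T (E j) (Finset.range (h j + 1))) ≠ ∞ := by
        rw [measure_levelUnion hT (hE j) (hdisj j)]
        exact ENNReal.mul_ne_top (ENNReal.natCast_ne_top _) hj
      change μ (levelUnion T (E j) (Finset.range (h j + 1)))ᶜ = ∞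
      rw [measure_compl hm hf, hinf, ENNReal.top_sub hf]
    have h1 := (measure_mono (μ := μ) (subset_union_right (s := ⋃ i ∈ I, level T (E j) i)
      (t := towerRest T (E j) (h j)))).trans (measure_le_add_symmDiff μ _ A)
    rw [hrest, symmDiff_comm] at h1
    exact (ENNReal.add_lt_top.2 ⟨hAf, (hAS.trans_le (min_le_right _ _)).trans
      ENNReal.one_lt_top⟩).not_ge h1

/-- Rank-one transformations of infinite measure are ergodic. -/
theorem IsRankOne.ergodic {μ : Measure X} [SigmaFinite μ] (hinf : μ univ = ∞)
    {T : X ≃ᵐ X} (hT : MeasurePreserving T μ μ) (hrank : IsRankOne μ T) : Ergodic T μ := by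
  refine ⟨hT, ⟨fun A hA hinv => ?_⟩⟩
  obtain ⟨E, h, hE, hdisj, happ⟩ := hrank.exists_levelUnion hinf hT
  have hinv' : T ⁻¹' Aᶜ = Aᶜ := by rw [preimage_compl, hinv]
  by_contra hcon
  have hA0 : 0 < μ A := by
    refine pos_iff_ne_zero.2 fun h0 => hcon ?_
    exact Filter.eventuallyConst_set'.2 (Or.inl (ae_eq_empty.2 h0))
  have hAc0 : 0 < μ Aᶜ := by
    refine pos_iff_ne_zero.2 fun h0 => hcon ?_
    exact Filter.eventuallyConst_set'.2 (Or.inr (ae_eq_univ.2 h0))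
  obtain ⟨C, hC, hCA, hC0, hCf⟩ := μ.exists_subset_measure_lt_top (r := 0) hA hA0
  obtain ⟨D, hD, hDA, hD0, hDf⟩ := μ.exists_subset_measure_lt_top (r := 0) hA.compl hAc0
  set ε := min (μ C / 2) (μ D / 2)
  have hε : 0 < ε := lt_min (ENNReal.half_pos hC0.ne') (ENNReal.half_pos hD0.ne')
  have hεf : ε ≠ ∞ := ((min_le_left _ _).trans_lt (ENNReal.div_lt_top hCf.ne two_ne_zero)).ne
  obtain ⟨j, ⟨I, hI, hCI⟩, K, hK, hDK⟩ :=
    ((happ C hC hCf ε hε).and (happ D hD hDf ε hε)).exists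
  -- An invariant set occupies the same measure in every level. A union of levels close to `C ⊆ A`
  -- thus forces `A` to take a large share of the base and `Aᶜ` a small one; `D ⊆ Aᶜ` forces the
  -- opposite.
  have key : ∀ (A C : Set X) (I : Finset ℕ), MeasurableSet A → T ⁻¹' A = A → C ⊆ A →
      I ⊆ Finset.range (h j + 1) → ε + ε ≤ μ C → μ (symmDiff C (levelUnion T (E j) I)) < ε →
      ε ≤ I.card * μ (A ∩ E j) ∧ I.card * μ (Aᶜ ∩ E j) < ε := by
    intro A C I hA hinv hCA hI hεC hCI
    have hd : (I : Set ℕ).PairwiseDisjoint (level T (E j)) :=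
      (hdisj j).subset (Finset.coe_subset.2 hI)
    have hinv' : T ⁻¹' Aᶜ = Aᶜ := by rw [preimage_compl, hinv]
    rw [← measure_inter_levelUnion hT hA hinv (hE j) hd,
      ← measure_inter_levelUnion hT hA.compl hinv' (hE j) hd]
    constructor
    · refine (ENNReal.add_le_add_iff_right hεf).1 (hεC.trans ?_)
      have : C ⊆ (A ∩ levelUnion T (E j) I) ∪ symmDiff C (levelUnion T (E j) I) := by
        intro x hx
        by_cases hr : x ∈ levelUnion T (E j) I
        · exact Or.inl ⟨hCA hx, hr⟩
        · exact Or.inr (Or.inl ⟨hx, hr⟩)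
      exact (measure_mono this).trans ((measure_union_le _ _).trans (by gcongr))
    · exact (measure_mono fun x hx => Or.inr ⟨hx.2, fun hxC => hx.1 (hCA hxC)⟩).trans_lt hCI
  have hC2 : ε + ε ≤ μ C := by
    rw [← ENNReal.add_halves (μ C)]
    exact add_le_add (min_le_left _ _) (min_le_left _ _)
  have hD2 : ε + ε ≤ μ D := by
    rw [← ENNReal.add_halves (μ D)]
    exact add_le_add (min_le_right _ _) (min_le_right _ _)
  obtain ⟨h1, h2⟩ := key A C I hA hinv hCA hI hC2 hCI
  obtain ⟨h3, h4⟩ := key Aᶜ D K hA.compl hinv' hDA hK hD2 hDK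
  rw [compl_compl] at h4
  -- Multiplying the bounds crosswise gives `ε * ε` both as a lower bound and as a strict upper
  -- bound of the same product, with no division by cardinalities.
  have h5 := mul_le_mul' h1 h3
  have h6 := ENNReal.mul_lt_mul h2 h4
  refine h6.not_ge (h5.trans_eq ?_)
  ring

/-! ### Self-joinings: marginals and invariance. -/

/-- Measures that agree with a σ-finite measure on its sets of finite measure are equal to it. -/
theorem measure_eq_of_forall_lt_top {μ μ' : Measure X} [SigmaFinite μ]
    (h : ∀ A, MeasurableSet A → μ A < ∞ → μ' A = μ A) : μ' = μ := by
  refine Measure.ext_of_iUnion_eq_univ (iUnion_spanningSets μ) fun n => ?_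
  ext A hA
  rw [Measure.restrict_apply hA, Measure.restrict_apply hA]
  exact h _ (hA.inter (measurableSet_spanningSets μ n))
    ((measure_mono inter_subset_right).trans_lt (measure_spanningSets_lt_top μ n))

namespace IsSelfJoining

variable {μ : Measure X} {T : X ≃ᵐ X} {ν : Measure (X × X)}

theorem map_fst [SigmaFinite μ] (hν : IsSelfJoining μ T ν) : ν.map Prod.fst = μ :=
  measure_eq_of_forall_lt_top fun A hA hAf => by
    rw [Measure.map_apply measurable_fst hA, ← Set.prod_univ, hν.prod_univ A hA hAf]

theorem map_snd [SigmaFinite μ] (hν : IsSelfJoining μ T ν) : ν.map Prod.snd = μ :=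
  measure_eq_of_forall_lt_top fun A hA hAf => by
    rw [Measure.map_apply measurable_snd hA, ← Set.univ_prod, hν.univ_prod A hA hAf]

theorem measure_prod_univ [SigmaFinite μ] (hν : IsSelfJoining μ T ν) {A : Set X}
    (hA : MeasurableSet A) : ν (A ×ˢ univ) = μ A := by
  conv_rhs => rw [← hν.map_fst, Measure.map_apply measurable_fst hA, ← Set.prod_univ]

theorem measure_univ_prod [SigmaFinite μ] (hν : IsSelfJoining μ T ν) {A : Set X}
    (hA : MeasurableSet A) : ν (univ ×ˢ A) = μ A := by
  conv_rhs => rw [← hν.map_snd, Measure.map_apply measurable_snd hA, ← Set.univ_prod]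

theorem measure_prod_le [SigmaFinite μ] (hν : IsSelfJoining μ T ν) {A B A' B' : Set X}
    (hA : MeasurableSet A) (hA' : MeasurableSet A') (hB : MeasurableSet B)
    (hB' : MeasurableSet B') :
    ν (A ×ˢ B) ≤ ν (A' ×ˢ B') + (μ (symmDiff A A') + μ (symmDiff B B')) := by
  rw [← hν.measure_prod_univ (hA.symmDiff hA'), ← hν.measure_univ_prod (hB.symmDiff hB')]
  refine (measure_mono ?_).trans ((measure_union_le _ _).trans (by
    gcongr; exact measure_union_le _ _))
  rintro ⟨x, y⟩ ⟨hx, hy⟩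
  by_cases hx' : x ∈ A'
  · by_cases hy' : y ∈ B'
    · exact Or.inl ⟨hx', hy'⟩
    · exact Or.inr (Or.inr ⟨mem_univ _, Or.inl ⟨hy, hy'⟩⟩)
  · exact Or.inr (Or.inl ⟨Or.inl ⟨hx, hx'⟩, mem_univ _⟩)

theorem measurePreserving (hν : IsSelfJoining μ T ν) :
    MeasurePreserving (Prod.map T T) ν ν :=
  ⟨T.measurable.prodMap T.measurable, hν.map_eq⟩

theorem measure_level_prod (hν : IsSelfJoining μ T ν) {E : Set X} (hE : MeasurableSet E)
    (a b c : ℕ) : ν (level T E (a + c) ×ˢ level T E (b + c)) = ν (level T E a ×ˢ level T E b) := by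
  induction c with
  | zero => rfl
  | succ c ih =>
    rw [← ih, ← hν.measurePreserving.measure_preimage
      ((measurableSet_level T hE _).prod (measurableSet_level T hE _)).nullMeasurableSet]
    change ν ((T ⁻¹' level T E (a + c + 1)) ×ˢ (T ⁻¹' level T E (b + c + 1))) = _
    rw [preimage_level_succ, preimage_level_succ]

end IsSelfJoining

/-! ### Graph joinings. -/

theorem graphMeasure_apply {μ : Measure X} {S : X → X} (hS : Measurable S) {F : Set (X × X)}
    (hF : MeasurableSet F) : graphMeasure μ S F = μ {x | (x, S x) ∈ F} := by
  unfold graphMeasure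
  rw [Measure.map_apply (measurable_id.prodMap hS) hF,
    Measure.map_apply (measurable_id'.prodMk measurable_id') ((measurable_id.prodMap hS) hF)]
  rfl

theorem graphMeasure_prod {μ : Measure X} {S : X → X} (hS : Measurable S) {A B : Set X}
    (hA : MeasurableSet A) (hB : MeasurableSet B) :
    graphMeasure μ S (A ×ˢ B) = μ (A ∩ S ⁻¹' B) :=
  graphMeasure_apply hS (hA.prod hB)

theorem graphMeasure_eq_map {μ : Measure X} {S : X → X} (hS : Measurable S) :
    graphMeasure μ S = μ.map fun x => (x, S x) := by
  ext F hF
  rw [graphMeasure_apply hS hF, Measure.map_apply (measurable_id'.prodMk hS) hF]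
  rfl

theorem isSelfJoining_graphMeasure {μ : Measure X} {T : X ≃ᵐ X} (hT : MeasurePreserving T μ μ)
    {S : X → X} (hS : MeasurePreserving S μ μ) (hcomm : ∀ᵐ x ∂μ, S (T x) = T (S x)) :
    IsSelfJoining μ T (graphMeasure μ S) where
  map_eq := by
    have hφ : Measurable fun x => (x, S x) := measurable_id'.prodMk hS.measurable
    rw [graphMeasure_eq_map hS.measurable,
      Measure.map_map (T.measurable.prodMap T.measurable) hφ]
    conv_rhs => rw [← hT.map_eq, Measure.map_map hφ T.measurable]
    refine Measure.map_congr ?_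
    filter_upwards [hcomm] with x hx
    simp [hx]
  univ_prod A hA _ := by
    rw [graphMeasure_prod hS.measurable MeasurableSet.univ hA, univ_inter,
      hS.measure_preimage hA.nullMeasurableSet]
  prod_univ A hA _ := by
    rw [graphMeasure_prod hS.measurable hA MeasurableSet.univ, preimage_univ, inter_univ]

/-- The map `x ↦ (x, S x)` carries `μ` to the graph measure and intertwines `T` with `T × T` almost
everywhere, so invariant sets pull back to almost invariant sets of `T`. -/
theorem ergodic_graphMeasure {μ : Measure X} {T : X ≃ᵐ X} (hT : Ergodic T μ)
    {S : X → X} (hS : MeasurePreserving S μ μ) (hcomm : ∀ᵐ x ∂μ, S (T x) = T (S x)) :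
    Ergodic (Prod.map T T) (graphMeasure μ S) := by
  refine ⟨(isSelfJoining_graphMeasure hT.toMeasurePreserving hS hcomm).measurePreserving,
    ⟨fun F hF hinv => ?_⟩⟩
  have hφ : Measurable fun x => (x, S x) := measurable_id'.prodMk hS.measurable
  have hmp : MeasurePreserving (fun x => (x, S x)) μ (graphMeasure μ S) :=
    ⟨hφ, (graphMeasure_eq_map hS.measurable).symm⟩
  rw [← hmp.aeconst_preimage hF.nullMeasurableSet]
  refine hT.quasiErgodic.aeconst_set₀ (hφ hF).nullMeasurableSet ?_
  filter_upwards [hcomm] with x hx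
  have h1 : (x, S x) ∈ Prod.map T T ⁻¹' F ↔ (x, S x) ∈ F := by rw [hinv]
  refine propext (Iff.trans ?_ h1)
  change (T x, S (T x)) ∈ F ↔ (T x, T (S x)) ∈ F
  rw [hx]

theorem isSelfJoining_zpowMap {μ : Measure X} {T : X ≃ᵐ X} (hT : MeasurePreserving T μ μ)
    (n : ℤ) : IsSelfJoining μ T (graphMeasure μ (zpowMap T n)) :=
  isSelfJoining_graphMeasure hT (measurePreserving_zpowMap hT n)
    (ae_of_all _ (zpowMap_comm T n))

/-! ### Domination of a self-joining by one off-diagonal. -/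

/-- Each pair of levels at offset `k` contributes a full copy of `E`, because `T^k` maps the first
level onto the second; for fixed `k` the pair is determined by its first index, so these copies are
disjoint. -/
theorem card_mul_le_graphMeasure {μ : Measure X} {T : X ≃ᵐ X} (hT : MeasurePreserving T μ μ)
    {E : Set X} (hE : MeasurableSet E) {I K : Finset ℕ}
    (hI : (I : Set ℕ).PairwiseDisjoint (level T E)) (k : ℤ) :
    ((I ×ˢ K).filter fun p => (p.2 : ℤ) - p.1 = k).card * μ E ≤
      graphMeasure μ (zpowMap T k) (levelUnion T E I ×ˢ levelUnion T E K) := by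
  set P := (I ×ˢ K).filter fun p => (p.2 : ℤ) - p.1 = k with hP
  have hinj : Set.InjOn Prod.fst (P : Set (ℕ × ℕ)) := by
    rintro ⟨a, b⟩ hp ⟨a', b'⟩ hp' h
    simp only [hP, Finset.coe_filter, mem_ofPred_eq] at hp hp'
    have h1 := hp.2
    have h2 := hp'.2
    simp only at h h1 h2
    ext <;> simp only <;> omega
  have hsub : P.image Prod.fst ⊆ I := by
    intro a ha
    obtain ⟨p, hp, rfl⟩ := Finset.mem_image.1 ha
    exact (Finset.mem_product.1 (Finset.mem_filter.1 hp).1).1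
  rw [← Finset.card_image_of_injOn hinj,
    ← measure_levelUnion hT hE (hI.subset (Finset.coe_subset.2 hsub)),
    graphMeasure_prod (measurable_zpowMap T k) (measurableSet_levelUnion T hE I)
      (measurableSet_levelUnion T hE K)]
  refine measure_mono fun x hx => ?_
  obtain ⟨a, ha, hxa⟩ := mem_iUnion₂.1 hx
  obtain ⟨⟨a', b⟩, hp, rfl⟩ := Finset.mem_image.1 ha
  have hpk := (Finset.mem_filter.1 hp).2
  refine ⟨mem_biUnion (hsub ha) hxa, ?_⟩
  obtain ⟨e, he, rfl⟩ := hxa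
  refine mem_biUnion (Finset.mem_product.1 (Finset.mem_filter.1 hp).1).2 ⟨e, he, ?_⟩
  exact (zpowMap_iterate T hpk e).symm

theorem levelUnion_prod_subset (T : X ≃ᵐ X) (E : Set X) (I K : Finset ℕ) :
    levelUnion T E I ×ˢ levelUnion T E K ⊆ ⋃ p ∈ I ×ˢ K, level T E p.1 ×ˢ level T E p.2 := by
  rintro ⟨x, y⟩ ⟨hx, hy⟩
  obtain ⟨a, ha, hxa⟩ := mem_iUnion₂.1 hx
  obtain ⟨b, hb, hyb⟩ := mem_iUnion₂.1 hy
  exact mem_biUnion (show (a, b) ∈ (I ×ˢ K : Finset (ℕ × ℕ)) from Finset.mk_mem_product ha hb)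
    ⟨hxa, hyb⟩

theorem sum_measure_disjoint_le {α ι : Type*} [MeasurableSpace α] (ν : Measure α) (s : Finset ι)
    {f : ι → Set α} (hf : ∀ i ∈ s, MeasurableSet (f i)) (hd : (s : Set ι).PairwiseDisjoint f)
    {t : Set α} (ht : ∀ i ∈ s, f i ⊆ t) : ∑ i ∈ s, ν (f i) ≤ ν t := by
  rw [← measure_biUnion_finset hd hf]
  exact measure_mono (iUnion₂_subset ht)

namespace IsSelfJoining

variable {μ : Measure X} {T : X ≃ᵐ X} {ν : Measure (X × X)}

/-- Some off-diagonal carries at least half of the mass that a self-joining gives to a family of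
rectangles composed of tower levels. -/
theorem exists_sum_levelUnion_le [SigmaFinite μ] (hT : MeasurePreserving T μ μ)
    (hν : IsSelfJoining μ T ν)
    {E : Set X} (hE : MeasurableSet E) {h : ℕ}
    (hd : ((Finset.range (h + 1) : Finset ℕ) : Set ℕ).PairwiseDisjoint (level T E))
    {ι : Type*} (s : Finset ι) {I K : ι → Finset ℕ} (hI : ∀ i, I i ⊆ Finset.range (h + 1))
    (hK : ∀ i, K i ⊆ Finset.range (h + 1)) :
    ∃ k : ℤ, ∑ i ∈ s, ν (levelUnion T E (I i) ×ˢ levelUnion T E (K i)) ≤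
      2 * ∑ i ∈ s, graphMeasure μ (zpowMap T k)
        (levelUnion T E (I i) ×ˢ levelUnion T E (K i)) := by
  -- One of the two truncated indices is always `0`: translating by `min a b` moves any pair of
  -- levels to one involving the base.
  set w : ℤ → ℝ≥0∞ := fun k => ν (level T E (-k).toNat ×ˢ level T E k.toNat) with hw
  have hwab : ∀ a b : ℕ, ν (level T E a ×ˢ level T E b) = w ((b : ℤ) - a) := by
    intro a b
    have := hν.measure_level_prod hE (-((b : ℤ) - a)).toNat ((b : ℤ) - a).toNat (min a b)
    refine Eq.trans ?_ this
    congr 3 <;> omega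
  have hLm : ∀ i, MeasurableSet (level T E i) := measurableSet_level T hE
  set D : Finset ℤ := Finset.Icc (-(h : ℤ)) h with hD
  -- Nonnegative offsets give disjoint pieces of `E × X`, nonpositive ones disjoint pieces of `X ×
  -- E`; offset `0` is counted twice, harmlessly.
  have hwsum : ∑ k ∈ D, w k ≤ 2 * μ E := by
    have hsub : D ⊆ ((Finset.range (h + 1)).image fun n : ℕ => (n : ℤ)) ∪
        (Finset.range (h + 1)).image fun n : ℕ => -(n : ℤ) := by
      intro k hk
      rw [hD, Finset.mem_Icc] at hk
      simp only [Finset.mem_union, Finset.mem_image, Finset.mem_range]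
      rcases le_total 0 k with h0 | h0
      · exact Or.inl ⟨k.toNat, by omega, by omega⟩
      · exact Or.inr ⟨(-k).toNat, by omega, by omega⟩
    have hunion : ∀ s t : Finset ℤ, ∑ k ∈ s ∪ t, w k ≤ ∑ k ∈ s, w k + ∑ k ∈ t, w k :=
      fun s t => by rw [← Finset.sum_union_inter]; exact le_self_add
    refine (Finset.sum_le_sum_of_subset hsub).trans ((hunion _ _).trans ?_)
    rw [Finset.sum_image (by intro a _ b _ h; simpa using h),
      Finset.sum_image (by intro a _ b _ h; simpa using h), two_mul]
    refine add_le_add ?_ ?_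
    · rw [← hν.measure_prod_univ hE]
      refine (Finset.sum_congr rfl fun n _ => ?_).trans_le (sum_measure_disjoint_le ν
        (Finset.range (h + 1)) (f := fun n => E ×ˢ level T E n) (fun n _ => hE.prod (hLm n))
        ?_ fun n _ => prod_mono_right (subset_univ _))
      · simpa [level_zero] using (hwab 0 n).symm
      · exact fun a ha b hb hab => Disjoint.set_prod_right (hd ha hb hab) _ _
    · rw [← hν.measure_univ_prod hE]
      refine (Finset.sum_congr rfl fun n _ => ?_).trans_le (sum_measure_disjoint_le ν
        (Finset.range (h + 1)) (f := fun n => level T E n ×ˢ E) (fun n _ => (hLm n).prod hE)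
        ?_ fun n _ => prod_mono_left (subset_univ _))
      · simpa [level_zero] using (hwab n 0).symm
      · exact fun a ha b hb hab => Disjoint.set_prod_left (hd ha hb hab) _ _
  set N : ℤ → ℝ≥0∞ := fun k => ∑ i ∈ s,
    (((I i ×ˢ K i).filter fun p => (p.2 : ℤ) - p.1 = k).card : ℝ≥0∞) with hN
  have hle : ∑ i ∈ s, ν (levelUnion T E (I i) ×ˢ levelUnion T E (K i)) ≤ ∑ k ∈ D, N k * w k := by
    simp only [hN, Finset.sum_mul]
    rw [Finset.sum_comm]
    refine Finset.sum_le_sum fun i _ => ?_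
    refine (measure_mono (levelUnion_prod_subset T E _ _)).trans
      ((measure_biUnion_finset_le _ _).trans_eq ?_)
    rw [← Finset.sum_fiberwise_of_maps_to (t := D) (g := fun p : ℕ × ℕ => (p.2 : ℤ) - p.1)]
    · refine Finset.sum_congr rfl fun k _ => ?_
      rw [← nsmul_eq_mul, ← Finset.sum_const]
      refine Finset.sum_congr rfl fun p hp => ?_
      rw [hwab, (Finset.mem_filter.1 hp).2]
    · intro p hp
      have h1 := Finset.mem_range.1 (hI i (Finset.mem_product.1 hp).1)
      have h2 := Finset.mem_range.1 (hK i (Finset.mem_product.1 hp).2)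
      rw [hD, Finset.mem_Icc]
      omega
  -- The chosen offset maximizes the number of pairs counted over the whole family, so a single `k`
  -- serves all rectangles.
  obtain ⟨k, -, hk⟩ := Finset.exists_max_image D N ⟨0, by rw [hD, Finset.mem_Icc]; omega⟩
  refine ⟨k, hle.trans ?_⟩
  calc ∑ l ∈ D, N l * w l ≤ ∑ l ∈ D, N k * w l :=
        Finset.sum_le_sum fun l hl => mul_le_mul_left (hk l hl) _
    _ = N k * ∑ l ∈ D, w l := (Finset.mul_sum _ _ _).symm
    _ ≤ N k * (2 * μ E) := mul_le_mul_right hwsum _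
    _ = 2 * ∑ i ∈ s,
        (((I i ×ˢ K i).filter fun p => (p.2 : ℤ) - p.1 = k).card : ℝ≥0∞) * μ E := by
        rw [← Finset.sum_mul]; ring
    _ ≤ _ := by
        gcongr with i
        exact card_mul_le_graphMeasure hT hE (hd.subset (Finset.coe_subset.2 (hI i))) k

/-- For a rank-one transformation of infinite measure, some power carries nearly half of the mass
that a self-joining gives to a finite family of rectangles. -/
theorem exists_sum_prod_le [SigmaFinite μ] (hinf : μ univ = ∞)
    (hT : MeasurePreserving T μ μ) (hrank : IsRankOne μ T) (hν : IsSelfJoining μ T ν)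
    {ι : Type*} (s : Finset ι) {A B : ι → Set X} (hA : ∀ i, MeasurableSet (A i))
    (hB : ∀ i, MeasurableSet (B i)) (hAf : ∀ i, μ (A i) < ∞) (hBf : ∀ i, μ (B i) < ∞)
    {η : ℝ≥0∞} (hη : 0 < η) :
    ∃ k : ℤ, ∑ i ∈ s, ν (A i ×ˢ B i) ≤
      2 * ∑ i ∈ s, graphMeasure μ (zpowMap T k) (A i ×ˢ B i) + η := by
  obtain ⟨E, h, hE, hd, happ⟩ := hrank.exists_levelUnion hinf hT
  -- Of the six errors per rectangle, two come from replacing its sides under `ν` and four from the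
  -- same replacement under `Δ`, doubled.
  obtain ⟨ε, hε, hεη⟩ : ∃ ε : ℝ≥0∞, 0 < ε ∧ 6 * s.card * ε ≤ η := by
    have hfin : (6 * s.card + 1 : ℝ≥0∞) ≠ ∞ := by finiteness
    refine ⟨η / (6 * s.card + 1), ENNReal.div_pos hη.ne' hfin, ?_⟩
    refine (mul_le_mul_left (le_self_add (b := 1)) _).trans ?_
    exact ENNReal.mul_div_le
  have hall : ∀ i ∈ s, ∀ᶠ j in atTop, ∃ I ⊆ Finset.range (h j + 1), ∃ K ⊆ Finset.range (h j + 1),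
      μ (symmDiff (A i) (levelUnion T (E j) I)) < ε ∧
      μ (symmDiff (B i) (levelUnion T (E j) K)) < ε := fun i _ => by
    filter_upwards [happ _ (hA i) (hAf i) ε hε, happ _ (hB i) (hBf i) ε hε]
      with j ⟨I, hI, hAI⟩ ⟨K, hK, hBK⟩
    exact ⟨I, hI, K, hK, hAI, hBK⟩
  obtain ⟨j, hj⟩ := ((Filter.eventually_all_finset s).2 hall).exists
  have hj' : ∀ i, ∃ I K : Finset ℕ, I ⊆ Finset.range (h j + 1) ∧ K ⊆ Finset.range (h j + 1) ∧
      (i ∈ s → μ (symmDiff (A i) (levelUnion T (E j) I)) < ε ∧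
        μ (symmDiff (B i) (levelUnion T (E j) K)) < ε) := fun i => by
    by_cases hi : i ∈ s
    · obtain ⟨I, hI, K, hK, h1⟩ := hj i hi
      exact ⟨I, K, hI, hK, fun _ => h1⟩
    · exact ⟨∅, ∅, Finset.empty_subset _, Finset.empty_subset _, fun h => absurd h hi⟩
  choose I K hI hK hIK using hj'
  obtain ⟨k, hk⟩ := hν.exists_sum_levelUnion_le hT (hE j) (hd j) s hI hK
  have hLm : ∀ I, MeasurableSet (levelUnion T (E j) I) := measurableSet_levelUnion T (hE j)
  refine ⟨k, ?_⟩
  set Δ := graphMeasure μ (zpowMap T k)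
  have hΔ : IsSelfJoining μ T Δ := isSelfJoining_zpowMap hT k
  calc ∑ i ∈ s, ν (A i ×ˢ B i)
      ≤ ∑ i ∈ s, (ν (levelUnion T (E j) (I i) ×ˢ levelUnion T (E j) (K i)) + (ε + ε)) := by
        refine Finset.sum_le_sum fun i hi => (hν.measure_prod_le (hA i) (hLm (I i)) (hB i)
          (hLm (K i))).trans ?_
        gcongr
        exacts [(hIK i hi).1.le, (hIK i hi).2.le]
    _ ≤ 2 * ∑ i ∈ s, Δ (levelUnion T (E j) (I i) ×ˢ levelUnion T (E j) (K i)) +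
          s.card * (ε + ε) := by
        rw [Finset.sum_add_distrib, Finset.sum_const, nsmul_eq_mul]
        gcongr
    _ ≤ 2 * ∑ i ∈ s, (Δ (A i ×ˢ B i) + (ε + ε)) + s.card * (ε + ε) := by
        gcongr with i hi
        refine (hΔ.measure_prod_le (hLm (I i)) (hA i) (hLm (K i)) (hB i)).trans ?_
        rw [symmDiff_comm, symmDiff_comm _ (B i)]
        gcongr
        exacts [(hIK i hi).1.le, (hIK i hi).2.le]
    _ = 2 * ∑ i ∈ s, Δ (A i ×ˢ B i) + 6 * s.card * ε := by
        rw [Finset.sum_add_distrib, Finset.sum_const, nsmul_eq_mul]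
        ring
    _ ≤ _ := by gcongr

end IsSelfJoining

/-! ### Weak operator compactness of contractions. -/

section WeakCompactness

variable {H : Type*} [NormedAddCommGroup H] [InnerProductSpace ℂ H] [CompleteSpace H]

/-- Along an ultrafilter, contractions converge in the weak operator topology. -/
theorem exists_tendsto_ofCLM {ι : Type*} (𝒰 : Ultrafilter ι) (u : ι → H →L[ℂ] H)
    (hu : ∀ i, ‖u i‖ ≤ 1) :
    ∃ P : H →WOT[ℂ] H, Tendsto (fun i => ContinuousLinearMapWOT.ofCLM (u i)) 𝒰 (𝓝 P) := by
  have hbound : ∀ x y i, ‖inner ℂ (u i x) y‖ ≤ 1 * ‖x‖ * ‖y‖ := fun x y i =>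
    (norm_inner_le_norm _ _).trans (by gcongr; exact (u i).le_of_opNorm_le (hu i) x)
  have hlim : ∀ x y, ∃ l : ℂ, ‖l‖ ≤ 1 * ‖x‖ * ‖y‖ ∧
      Tendsto (fun i => inner ℂ (u i x) y) 𝒰 (𝓝 l) := by
    intro x y
    obtain ⟨l, hl, hle⟩ := (isCompact_closedBall (0 : ℂ) (1 * ‖x‖ * ‖y‖)).ultrafilter_le_nhds
      (𝒰.map fun i => inner ℂ (u i x) y) (by
        exact le_principal_iff.2 (Ultrafilter.mem_map.2 (univ_mem' fun i =>
          mem_closedBall_zero_iff.2 (hbound x y i))))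
    exact ⟨l, mem_closedBall_zero_iff.1 hl, hle⟩
  choose l hl hlt using hlim
  -- The limits of matrix coefficients form a bounded sesquilinear form, which Riesz representation
  -- turns into the limit operator.
  let B : H →ₗ⋆[ℂ] H →ₗ[ℂ] ℂ := LinearMap.mk₂'ₛₗ (starRingEnd ℂ) (RingHom.id ℂ) l
    (fun x x' y => tendsto_nhds_unique (hlt (x + x') y) (by
      simpa only [map_add, inner_add_left] using (hlt x y).add (hlt x' y)))
    (fun c x y => tendsto_nhds_unique (hlt (c • x) y) (by
      simpa only [map_smul, inner_smul_left, smul_eq_mul] using (hlt x y).const_mul (starRingEnd ℂ c)))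
    (fun x y y' => tendsto_nhds_unique (hlt x (y + y')) (by
      simpa only [inner_add_right] using (hlt x y).add (hlt x y')))
    (fun c x y => tendsto_nhds_unique (hlt x (c • y)) (by
      simpa only [inner_smul_right, smul_eq_mul, RingHom.id_apply] using (hlt x y).const_mul c))
  let P : H →L[ℂ] H := InnerProductSpace.continuousLinearMapOfBilin (B.mkContinuous₂ 1 hl)
  refine ⟨ContinuousLinearMapWOT.ofCLM P,
    ContinuousLinearMapWOT.tendsto_iff_forall_inner_apply_tendsto.2 fun x y => ?_⟩
  have hP : inner ℂ (P x) y = l x y := InnerProductSpace.continuousLinearMapOfBilin_apply _ _ _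
  have := (Complex.continuous_conj.tendsto _).comp (hlt x y)
  rw [← hP] at this
  simpa [Function.comp_def, inner_conj_symm] using this

end WeakCompactness

/-! ### Finite unions of rectangles. -/

/-- Subsets of `X × X` that are unions of cells of the square of a finite measurable partition. -/
def gridSets (X : Type*) [MeasurableSpace X] : Set (Set (X × X)) :=
  {R | ∃ (ι : Type) (_ : Fintype ι) (_ : MeasurableSpace ι) (_ : MeasurableSingletonClass ι)
    (u : X → ι) (D : Set (ι × ι)), Measurable u ∧ R = {p | (u p.1, u p.2) ∈ D}}

theorem measurableSet_of_mem_gridSets {R : Set (X × X)} (hR : R ∈ gridSets X) :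
    MeasurableSet R := by
  obtain ⟨ι, _, _, _, u, D, hu, rfl⟩ := hR
  exact ((hu.comp measurable_fst).prodMk (hu.comp measurable_snd)) D.toFinite.measurableSet

/-- Two labellings combine into `x ↦ (u x, u' x)`, the common refinement, over which both sets are
unions of cells. -/
theorem isSetRing_gridSets : IsSetRing (gridSets X) where
  empty_mem := ⟨Unit, inferInstance, inferInstance, inferInstance, fun _ => (), ∅,
    measurable_const, rfl⟩
  union_mem := by
    rintro _ _ ⟨ι, _, _, _, u, D, hu, rfl⟩ ⟨ι', _, _, _, u', D', hu', rfl⟩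
    exact ⟨ι × ι', inferInstance, inferInstance, inferInstance, fun x => (u x, u' x),
      {p | (p.1.1, p.2.1) ∈ D ∨ (p.1.2, p.2.2) ∈ D'}, hu.prodMk hu', rfl⟩
  sdiff_mem := by
    rintro _ _ ⟨ι, _, _, _, u, D, hu, rfl⟩ ⟨ι', _, _, _, u', D', hu', rfl⟩
    exact ⟨ι × ι', inferInstance, inferInstance, inferInstance, fun x => (u x, u' x),
      {p | (p.1.1, p.2.1) ∈ D ∧ (p.1.2, p.2.2) ∉ D'}, hu.prodMk hu', rfl⟩

theorem prod_mem_gridSets {A B : Set X} (hA : MeasurableSet A) (hB : MeasurableSet B) :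
    A ×ˢ B ∈ gridSets X :=
  ⟨Prop × Prop, inferInstance, inferInstance, inferInstance, fun x => (x ∈ A, x ∈ B),
    {p | p.1.1 ∧ p.2.2}, hA.mem.prodMk hB.mem, rfl⟩

theorem generateFrom_gridSets :
    (Prod.instMeasurableSpace : MeasurableSpace (X × X)) =
      MeasurableSpace.generateFrom (gridSets X) := by
  refine le_antisymm ?_ (MeasurableSpace.generateFrom_le fun _ => measurableSet_of_mem_gridSets)
  rw [← generateFrom_prod]
  refine MeasurableSpace.generateFrom_mono ?_
  rintro _ ⟨A, hA, B, hB, rfl⟩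
  exact prod_mem_gridSets hA hB

theorem exists_gridSets_symmDiff_lt (ρ : Measure (X × X)) [IsFiniteMeasure ρ] {F : Set (X × X)}
    (hF : MeasurableSet F) {ε : ℝ≥0∞} (hε : 0 < ε) :
    ∃ C ∈ gridSets X, ρ (symmDiff C F) < ε :=
  exists_measure_symmDiff_lt_of_generateFrom_isSetRing isSetRing_gridSets
    ⟨{univ}, countable_singleton _, by
      rw [singleton_subset_iff, ← univ_prod_univ]
      exact prod_mem_gridSets MeasurableSet.univ MeasurableSet.univ, by simp⟩
    generateFrom_gridSets hF hε

/-- A finite disjoint union of measurable rectangles contained in `A × A`. -/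
def IsRectUnion (A : Set X) (R : Set (X × X)) : Prop :=
  ∃ (ι : Type) (_ : Fintype ι) (U V : ι → Set X), (∀ i, MeasurableSet (U i)) ∧
    (∀ i, MeasurableSet (V i)) ∧ (∀ i, U i ⊆ A) ∧ (∀ i, V i ⊆ A) ∧
    Pairwise (Function.onFun Disjoint fun i => U i ×ˢ V i) ∧ R = ⋃ i, U i ×ˢ V i

/-- Cells of a product partition are already disjoint rectangles. Disjointness is what makes the
measure of the union a plain sum of matrix coefficients of operators. -/
theorem isRectUnion_inter {A : Set X} (hA : MeasurableSet A) {C : Set (X × X)}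
    (hC : C ∈ gridSets X) : IsRectUnion A (A ×ˢ A ∩ C) := by
  obtain ⟨ι, _, _, _, u, D, hu, rfl⟩ := hC
  refine ⟨D, Fintype.ofFinite D, fun d => A ∩ u ⁻¹' {d.1.1}, fun d => A ∩ u ⁻¹' {d.1.2},
    fun d => hA.inter (hu (measurableSet_singleton _)),
    fun d => hA.inter (hu (measurableSet_singleton _)),
    fun d => inter_subset_left, fun d => inter_subset_left, fun d d' hdd' => ?_, ?_⟩
  · refine disjoint_left.2 fun p hp hp' => hdd' (Subtype.ext (Prod.ext ?_ ?_))
    · exact hp.1.2.symm.trans hp'.1.2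
    · exact hp.2.2.symm.trans hp'.2.2
  · ext p
    simp only [mem_iUnion]
    constructor
    · rintro ⟨hp, hpD⟩
      exact ⟨⟨_, hpD⟩, ⟨hp.1, rfl⟩, ⟨hp.2, rfl⟩⟩
    · rintro ⟨d, hd1, hd2⟩
      refine ⟨⟨hd1.1, hd2.1⟩, ?_⟩
      have h1 : u p.1 = d.1.1 := hd1.2
      have h2 : u p.2 = d.1.2 := hd2.2
      change (u p.1, u p.2) ∈ D
      rw [h1, h2]
      exact d.2

namespace IsRectUnion

variable {μ : Measure X} {T : X ≃ᵐ X} {A : Set X} {R : Set (X × X)}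

/-- The functional on operators on `L²` whose value at `T ^ n` is `Δ_{T ^ n} R`. -/
theorem exists_functional (hR : IsRectUnion A R) (hT : MeasurePreserving T μ μ) (hA : μ A < ∞) :
    ∃ Φ : (Lp ℂ 2 μ →WOT[ℂ] Lp ℂ 2 μ) →ₗ[ℂ] ℂ, Continuous Φ ∧
      ∀ n : ℤ, Φ (ContinuousLinearMapWOT.ofCLM (koopman μ T hT n)) =
        ((graphMeasure μ (zpowMap T n)).real R : ℂ) := by
  obtain ⟨ι, _, U, V, hU, hV, hUA, hVA, hd, rfl⟩ := hR
  have hUf : ∀ i, μ (U i) ≠ ∞ := fun i => ((measure_mono (hUA i)).trans_lt hA).ne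
  have hVf : ∀ i, μ (V i) ≠ ∞ := fun i => ((measure_mono (hVA i)).trans_lt hA).ne
  refine ⟨{ toFun := fun P => ∑ i, inner ℂ (indicatorConstLp 2 (hU i) (hUf i) (1 : ℂ))
              (P (indicatorConstLp 2 (hV i) (hVf i) (1 : ℂ)))
            map_add' := fun P P' => by
              simp [inner_add_right, Finset.sum_add_distrib]
            map_smul' := fun c P => by
              simp [inner_smul_right, Finset.mul_sum] }, ?_, fun n => ?_⟩
  · refine continuous_finsetSum _ fun i _ => ?_
    exact ContinuousLinearMapWOT.continuous_iff.1 continuous_id _ _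
  · have hn := measurePreserving_zpowMap hT n
    have hterm : ∀ i, inner ℂ (indicatorConstLp 2 (hU i) (hUf i) (1 : ℂ))
        (koopman μ T hT n (indicatorConstLp 2 (hV i) (hVf i) (1 : ℂ))) =
        ((graphMeasure μ (zpowMap T n)).real (U i ×ˢ V i) : ℂ) := by
      intro i
      have hVn : μ (zpowMap T n ⁻¹' V i) ≠ ∞ := by
        rw [hn.measure_preimage (hV i).nullMeasurableSet]; exact hVf i
      have hk : koopman μ T hT n (indicatorConstLp 2 (hV i) (hVf i) (1 : ℂ)) =
          indicatorConstLp 2 (hn.measurable (hV i)) hVn (1 : ℂ) := rfl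
      rw [hk, L2.inner_indicatorConstLp_one_indicatorConstLp_one (hU i)
          (hn.measurable (hV i)) (hUf i) hVn, measureReal_def,
        measureReal_def, graphMeasure_prod hn.measurable (hU i) (hV i)]
      rfl
    have hfin : ∀ i, graphMeasure μ (zpowMap T n) (U i ×ˢ V i) ≠ ∞ := fun i => by
      rw [graphMeasure_prod hn.measurable (hU i) (hV i)]
      exact measure_ne_top_of_subset inter_subset_left (hUf i)
    change ∑ i, inner ℂ (indicatorConstLp 2 (hU i) (hUf i) (1 : ℂ))
        (koopman μ T hT n (indicatorConstLp 2 (hV i) (hVf i) (1 : ℂ))) = _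
    simp only [hterm]
    rw [measureReal_iUnion_fintype hd (fun i => (hU i).prod (hV i)) hfin]
    push_cast
    rfl

theorem exists_measure_le [SigmaFinite μ] (hR : IsRectUnion A R) (hinf : μ univ = ∞)
    (hT : MeasurePreserving T μ μ) (hrank : IsRankOne μ T) (hA : μ A < ∞) {ν : Measure (X × X)}
    (hν : IsSelfJoining μ T ν) {η : ℝ≥0∞} (hη : 0 < η) :
    ∃ k : ℤ, ν R ≤ 2 * graphMeasure μ (zpowMap T k) R + η := by
  obtain ⟨ι, _, U, V, hU, hV, hUA, hVA, hd, rfl⟩ := hR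
  obtain ⟨k, hk⟩ := hν.exists_sum_prod_le hinf hT hrank Finset.univ hU hV
    (fun i => (measure_mono (hUA i)).trans_lt hA) (fun i => (measure_mono (hVA i)).trans_lt hA) hη
  refine ⟨k, ?_⟩
  have hsum : ∀ ρ : Measure (X × X), ρ (⋃ i, U i ×ˢ V i) = ∑ i, ρ (U i ×ˢ V i) := fun ρ => by
    rw [measure_iUnion hd fun i => (hU i).prod (hV i), tsum_fintype]
  rwa [hsum, hsum]

end IsRectUnion

/-! ### Self-joinings and graphs of powers. -/

/-- The graph of `T ^ n`. -/
def graphSet (T : X ≃ᵐ X) (n : ℤ) : Set (X × X) := {p | p.2 = zpowMap T n p.1}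

theorem measurableSet_graphSet [StandardBorelSpace X] (T : X ≃ᵐ X) (n : ℤ) :
    MeasurableSet (graphSet T n) :=
  measurableSet_eq_fun measurable_snd ((measurable_zpowMap T n).comp measurable_fst)

theorem graphMeasure_compl_graphSet [StandardBorelSpace X] (μ : Measure X) (T : X ≃ᵐ X) (n : ℤ) :
    graphMeasure μ (zpowMap T n) (graphSet T n)ᶜ = 0 := by
  rw [graphMeasure_apply (measurable_zpowMap T n) (measurableSet_graphSet T n).compl]
  simp [graphSet]

namespace IsSelfJoining

variable {μ : Measure X} {T : X ≃ᵐ X} {ν : Measure (X × X)}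

theorem measure_square_lt_top [SigmaFinite μ] (hν : IsSelfJoining μ T ν) {A : Set X}
    (hA : MeasurableSet A) (hAf : μ A < ∞) : ν (A ×ˢ A) < ∞ :=
  (measure_mono (prod_mono_right (subset_univ A))).trans_lt
    ((hν.measure_prod_univ hA).trans_lt hAf)

/-- Squares of an increasing exhaustion cover `X × X`, whose `ν`-mass is `μ univ = ∞`. -/
theorem exists_square_pos [SigmaFinite μ] (hinf : μ univ = ∞) (hν : IsSelfJoining μ T ν) :
    ∃ A : Set X, MeasurableSet A ∧ μ A < ∞ ∧ ν (A ×ˢ A) ≠ 0 := by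
  by_contra! hcon
  have hU : (⋃ n, spanningSets μ n ×ˢ spanningSets μ n) = univ := by
    refine eq_univ_of_forall fun p => mem_iUnion.2
      ⟨max (spanningSetsIndex μ p.1) (spanningSetsIndex μ p.2), ?_, ?_⟩
    · exact monotone_spanningSets μ (le_max_left _ _) (mem_spanningSetsIndex μ p.1)
    · exact monotone_spanningSets μ (le_max_right _ _) (mem_spanningSetsIndex μ p.2)
  have h0 : ν univ = 0 := by
    rw [← hU]
    exact measure_iUnion_null fun n => hcon _ (measurableSet_spanningSets μ n)
      (measure_spanningSets_lt_top μ n)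
  rw [← univ_prod_univ, hν.measure_prod_univ MeasurableSet.univ, hinf] at h0
  exact ENNReal.top_ne_zero h0

/-- A self-joining giving zero mass to all the graphs of powers of `T` can be separated from their
graph measures by finite unions of rectangles. -/
theorem exists_separating [StandardBorelSpace X] [SigmaFinite μ] (hT : MeasurePreserving T μ μ)
    (hν : IsSelfJoining μ T ν) (h0 : ∀ n, ν (graphSet T n) = 0) {A : Set X}
    (hA : MeasurableSet A) (hAf : μ A < ∞) (hpos : ν (A ×ˢ A) ≠ 0) :
    ∃ R : ℕ → Set (X × X), (∀ m, IsRectUnion A (R m)) ∧ Antitone R ∧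
      (∀ m, ν (A ×ˢ A) / 2 ≤ ν (R m)) ∧
      ∀ n, Tendsto (fun m => graphMeasure μ (zpowMap T n) (R m)) atTop (𝓝 0) := by
  set Q := A ×ˢ A
  have hQf : ∀ ν', IsSelfJoining μ T ν' → ν' Q < ∞ := fun ν' hν' =>
    hν'.measure_square_lt_top hA hAf
  have hQm : MeasurableSet Q := hA.prod hA
  -- The total error stays below half of `ν Q`, so intersecting all approximants loses at most half
  -- of the mass.
  obtain ⟨ε, hε, hεsum⟩ := ENNReal.exists_pos_sum_of_countable' (ENNReal.half_pos hpos).ne' ℕ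
  set G := ⋃ n, graphSet T n with hG
  have hGm : MeasurableSet G := MeasurableSet.iUnion fun n => measurableSet_graphSet T n
  have hG0 : ν G = 0 := measure_iUnion_null h0
  have hGc : ∀ n, graphMeasure μ (zpowMap T n) Gᶜ = 0 := fun n =>
    measure_mono_null (compl_subset_compl.2 (subset_iUnion _ n))
      (graphMeasure_compl_graphSet μ T n)
  have happ : ∀ m : ℕ, ∃ C ∈ gridSets X, ν (Q ∩ symmDiff C (Q \ G)) ≤ ε m ∧
      ∀ n ∈ Finset.Icc (-(m : ℤ)) m,
        graphMeasure μ (zpowMap T n) (Q ∩ symmDiff C (Q \ G)) ≤ ε m := by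
    intro m
    -- One approximation in this finite measure controls `ν` and all `Δ_{T^n}` with `|n| ≤ m` at
    -- once. The target `Q \ G` has full `ν`-mass in `Q` and is null for every graph measure.
    let ρ : Measure (X × X) := ν.restrict Q +
      ∑ n ∈ Finset.Icc (-(m : ℤ)) m, (graphMeasure μ (zpowMap T n)).restrict Q
    have hρ : IsFiniteMeasure ρ := by
      constructor
      simp only [ρ, Measure.add_apply, Measure.finsetSum_apply, Measure.restrict_apply_univ]
      exact ENNReal.add_lt_top.2 ⟨hQf ν hν, ENNReal.sum_lt_top.2 fun n _ =>
        hQf _ (isSelfJoining_zpowMap hT n)⟩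
    obtain ⟨C, hC, hCε⟩ := exists_gridSets_symmDiff_lt ρ (hQm.diff hGm) (hε m)
    have hm : MeasurableSet (symmDiff C (Q \ G)) :=
      (measurableSet_of_mem_gridSets hC).symmDiff (hQm.diff hGm)
    simp only [ρ, Measure.add_apply, Measure.finsetSum_apply, Measure.restrict_apply hm] at hCε
    simp only [inter_comm Q]
    exact ⟨C, hC, le_self_add.trans hCε.le, fun n hn => (Finset.single_le_sum (f := fun n =>
      graphMeasure μ (zpowMap T n) (symmDiff C (Q \ G) ∩ Q)) (fun _ _ => zero_le) hn).trans
      (le_add_self.trans hCε.le)⟩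
  choose C hC hCν hCΔ using happ
  -- Intersecting makes the sequence decreasing and keeps `D m ⊆ C m`, hence the graph-measure
  -- bounds.
  let D : ℕ → Set (X × X) := fun m => ⋂ l ∈ Finset.range (m + 1), C l
  have hD : ∀ m, D m ∈ gridSets X := by
    intro m
    induction m with
    | zero => simpa [D] using hC 0
    | succ m ih =>
      have : D (m + 1) = C (m + 1) ∩ D m := by
        simp only [D]
        rw [Finset.range_add_one, Finset.set_biInter_insert]
      rw [this]
      exact isSetRing_gridSets.inter_mem (hC _) ih
  refine ⟨fun m => Q ∩ D m, fun m => isRectUnion_inter hA (hD m), ?_, fun m => ?_, fun n => ?_⟩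
  · intro l m hlm
    refine inter_subset_inter_right _ (biInter_subset_biInter_left ?_)
    intro i hi
    have : i < l + 1 := Finset.mem_range.1 hi
    exact Finset.mem_range.2 (by omega)
  · have hsub : Q ⊆ (Q ∩ D m) ∪ (G ∪ ⋃ l ∈ Finset.range (m + 1), Q ∩ symmDiff (C l) (Q \ G)) := by
      intro p hp
      by_cases hpD : p ∈ D m
      · exact Or.inl ⟨hp, hpD⟩
      by_cases hpG : p ∈ G
      · exact Or.inr (Or.inl hpG)
      · simp only [D, mem_iInter, not_forall] at hpD
        obtain ⟨l, hl, hpl⟩ := hpD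
        exact Or.inr (Or.inr (mem_biUnion hl ⟨hp, Or.inr ⟨⟨hp, hpG⟩, hpl⟩⟩))
    have h1 : ν Q ≤ ν (Q ∩ D m) + ν Q / 2 := by
      refine (measure_mono hsub).trans ((measure_union_le _ _).trans ?_)
      gcongr
      refine (measure_union_le _ _).trans ?_
      rw [hG0, zero_add]
      refine (measure_biUnion_finset_le _ _).trans ((Finset.sum_le_sum fun l _ => hCν l).trans ?_)
      exact (ENNReal.sum_le_tsum _).trans hεsum.le
    conv_lhs at h1 => rw [← ENNReal.add_halves (ν Q)]
    exact (ENNReal.add_le_add_iff_right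
      (ENNReal.div_lt_top (hQf ν hν).ne two_ne_zero).ne).1 h1
  · refine tendsto_of_tendsto_of_tendsto_of_le_of_le' tendsto_const_nhds
      (ENNReal.tendsto_atTop_zero_of_tsum_ne_top (hεsum.trans_le le_top).ne)
      (Eventually.of_forall fun _ => zero_le) ?_
    filter_upwards [eventually_ge_atTop n.natAbs] with m hm
    have hsub : Q ∩ D m ⊆ Gᶜ ∪ Q ∩ symmDiff (C m) (Q \ G) := by
      intro p hp
      by_cases hpG : p ∈ G
      · refine Or.inr ⟨hp.1, Or.inl ⟨?_, fun h => h.2 hpG⟩⟩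
        exact mem_iInter₂.1 hp.2 m (Finset.self_mem_range_succ m)
      · exact Or.inl hpG
    refine (measure_mono hsub).trans ((measure_union_le _ _).trans ?_)
    rw [hGc, zero_add]
    exact hCΔ m n (Finset.mem_Icc.2 (by omega))

/-- Under polynomial weak closure, a self-joining charges the graph of some power of `T`. -/
theorem exists_graphSet_ne_zero [StandardBorelSpace X] [SigmaFinite μ] (hinf : μ univ = ∞)
    (hT : MeasurePreserving T μ μ) (hrank : IsRankOne μ T)
    (hpoly : HasPolynomialWeakClosure μ T hT) (hν : IsSelfJoining μ T ν) :
    ∃ n, ν (graphSet T n) ≠ 0 := by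
  by_contra! h0
  obtain ⟨A, hA, hAf, hpos⟩ := hν.exists_square_pos hinf
  obtain ⟨R, hR, hanti, hRν, hRΔ⟩ := hν.exists_separating hT h0 hA hAf hpos
  set c := ν (A ×ˢ A) / 2 with hc
  have hc0 : c ≠ 0 := (ENNReal.half_pos hpos).ne'
  have hcf : c ≠ ∞ := (ENNReal.div_lt_top (hν.measure_square_lt_top hA hAf).ne two_ne_zero).ne
  have hRf : ∀ n m, graphMeasure μ (zpowMap T n) (R m) ≠ ∞ := fun n m => by
    refine measure_ne_top_of_subset ?_
      ((isSelfJoining_zpowMap hT n).measure_square_lt_top hA hAf).ne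
    obtain ⟨ι, _, U, V, -, -, hU, hV, -, h⟩ := hR m
    rw [h]
    exact iUnion_subset fun i => prod_mono (hU i) (hV i)
  -- From `c ≤ ν (R m) ≤ 2 Δ (R m) + c / 2`.
  have hk : ∀ m, ∃ k : ℤ, c / 4 ≤ graphMeasure μ (zpowMap T k) (R m) := by
    intro m
    obtain ⟨k, hk⟩ := (hR m).exists_measure_le hinf hT hrank hAf hν (ENNReal.half_pos hc0)
    refine ⟨k, ?_⟩
    have h1 := (hRν m).trans hk
    conv_lhs at h1 => rw [← ENNReal.add_halves c]
    have h2 := (ENNReal.add_le_add_iff_right (ENNReal.div_lt_top hcf two_ne_zero).ne).1 h1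
    refine ENNReal.div_le_of_le_mul ?_
    rw [ENNReal.div_le_iff two_ne_zero ENNReal.ofNat_ne_top] at h2
    refine h2.trans_eq ?_
    ring
  choose k hk using hk
  set δ := (c / 4).toReal
  have hδ0 : 0 < δ := ENNReal.toReal_pos (ENNReal.div_pos hc0 ENNReal.ofNat_ne_top).ne'
    (ENNReal.div_lt_top hcf four_ne_zero).ne
  let 𝒰 : Ultrafilter ℕ := Ultrafilter.of atTop
  have h𝒰 : (𝒰 : Filter ℕ) ≤ atTop := Ultrafilter.of_le atTop
  obtain ⟨P, hP⟩ := exists_tendsto_ofCLM 𝒰 (fun m => koopman μ T hT (k m))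
    fun m => LinearIsometry.norm_toContinuousLinearMap_le _
  have hPcl : P ∈ closure (powersWOT μ T hT) :=
    mem_closure_of_tendsto hP (Eventually.of_forall fun m => mem_range_self (k m))
  obtain ⟨a, ha⟩ := Finsupp.mem_span_range_iff_exists_finsupp.1 (hpoly hPcl)
  have hΦ : ∀ l, δ ≤ ∑ n ∈ a.support, ‖a n‖ * (graphMeasure μ (zpowMap T n)).real (R l) := by
    intro l
    obtain ⟨Φ, hΦc, hΦ⟩ := (hR l).exists_functional hT hAf
    have hlim := ((hΦc.tendsto P).comp hP).norm
    -- For `m ≥ l`, `R m ⊆ R l` gives `Δ_{T^(k m)} (R l) ≥ c / 4`; continuity passes the bound to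
    -- the limit `P`.
    have hge : δ ≤ ‖Φ P‖ := by
      refine ge_of_tendsto hlim (h𝒰 ?_)
      filter_upwards [eventually_ge_atTop l] with m hm
      simp only [Function.comp_apply, hΦ, Complex.norm_real, Real.norm_eq_abs]
      refine le_trans ?_ (le_abs_self _)
      exact ENNReal.toReal_mono (hRf _ _) ((hk m).trans (measure_mono (hanti hm)))
    refine hge.trans ?_
    rw [← ha, Finsupp.sum, map_sum]
    refine (norm_sum_le _ _).trans (Finset.sum_le_sum fun n _ => ?_)
    rw [map_smul, hΦ, norm_smul, Complex.norm_real, Real.norm_of_nonneg measureReal_nonneg]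
  -- Finiteness of the combination is essential: the convergence `Δ_{T^n} (R l) → 0` is only known
  -- for each `n` separately.
  have hlim : Tendsto (fun l => ∑ n ∈ a.support,
      ‖a n‖ * (graphMeasure μ (zpowMap T n)).real (R l)) atTop (𝓝 0) := by
    have : (0 : ℝ) = ∑ n ∈ a.support, ‖a n‖ * 0 := by simp
    rw [this]
    refine tendsto_finsetSum _ fun n _ => Tendsto.const_mul _ ?_
    exact (ENNReal.tendsto_toReal ENNReal.zero_ne_top).comp (hRΔ n)
  exact hδ0.not_ge (ge_of_tendsto' hlim hΦ)

/-- A self-joining supported on the graph of `T ^ n` is the graph measure of `T ^ n`. -/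
theorem eq_graphMeasure [SigmaFinite μ] (hν : IsSelfJoining μ T ν) {n : ℤ}
    (h : ν (graphSet T n)ᶜ = 0) : ν = graphMeasure μ (zpowMap T n) := by
  have hn := measurable_zpowMap T n
  have hae : (id : X × X → X × X) =ᵐ[ν] (fun x => (x, zpowMap T n x)) ∘ Prod.fst := by
    filter_upwards [compl_mem_ae_iff.2 h] with p hp
    rw [compl_compl] at hp
    exact Prod.ext rfl hp
  rw [graphMeasure_eq_map hn, ← hν.map_fst,
    Measure.map_map (measurable_id'.prodMk hn) measurable_fst, ← Measure.map_congr hae,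
    Measure.map_id]

end IsSelfJoining

/-! ### Ergodic self-joinings and the centralizer. -/

theorem preimage_graphSet (T : X ≃ᵐ X) (n : ℤ) :
    Prod.map T T ⁻¹' graphSet T n = graphSet T n := by
  ext p
  simp [graphSet, zpowMap_comm]

theorem exists_eq_graphMeasure [StandardBorelSpace X] {μ : Measure X} [SigmaFinite μ]
    (hinf : μ univ = ∞) {T : X ≃ᵐ X} (hT : MeasurePreserving T μ μ) (hrank : IsRankOne μ T)
    (hpoly : HasPolynomialWeakClosure μ T hT) {ν : Measure (X × X)} (hν : IsSelfJoining μ T ν)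
    (herg : Ergodic (Prod.map T T) ν) : ∃ n : ℤ, ν = graphMeasure μ (zpowMap T n) := by
  obtain ⟨n, hn⟩ := hν.exists_graphSet_ne_zero hinf hT hrank hpoly
  refine ⟨n, hν.eq_graphMeasure ?_⟩
  exact (herg.measure_self_or_compl_eq_zero (measurableSet_graphSet T n)
    (preimage_graphSet T n)).resolve_left hn

end RankOneJoinings

theorem mainTheorem2 {X : Type*} [MeasurableSpace X] [StandardBorelSpace X]
    (μ : MeasureTheory.Measure X) [MeasureTheory.SigmaFinite μ] (hinf : μ Set.univ = ⊤)
    (T : X ≃ᵐ X) (hT : MeasureTheory.MeasurePreserving T μ μ)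
    (hrank : RankOneJoinings.IsRankOne μ T)
    (hpoly : RankOneJoinings.HasPolynomialWeakClosure μ T hT) :
    RankOneJoinings.HasMinimalSelfJoinings μ T ∧ RankOneJoinings.HasTrivialCentralizer μ T := by
  have hergT := hrank.ergodic hinf hT
  refine ⟨fun ν => ⟨fun h => RankOneJoinings.exists_eq_graphMeasure hinf hT hrank hpoly h.1 h.2,
    ?_⟩, fun S hS hcomm => ?_⟩
  · rintro ⟨n, rfl⟩
    exact ⟨RankOneJoinings.isSelfJoining_zpowMap hT n,
      RankOneJoinings.ergodic_graphMeasure hergT (RankOneJoinings.measurePreserving_zpowMap hT n)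
        (ae_of_all _ (RankOneJoinings.zpowMap_comm T n))⟩
  -- The graph joining of `S` is ergodic, so it equals some `Δ_{T^n}`; its giving no mass to the
  -- complement of the graph of `T^n` says exactly that `S = T^n` almost everywhere.
  · obtain ⟨n, hn⟩ := RankOneJoinings.exists_eq_graphMeasure hinf hT hrank hpoly
      (RankOneJoinings.isSelfJoining_graphMeasure hT hS hcomm)
      (RankOneJoinings.ergodic_graphMeasure hergT hS hcomm)
    refine ⟨n, ?_⟩
    have h0 := RankOneJoinings.graphMeasure_compl_graphSet μ T n
    rw [← hn, RankOneJoinings.graphMeasure_apply hS.measurable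
      (RankOneJoinings.measurableSet_graphSet T n).compl] at h0
    exact h0
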